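/- Let $f$ be a meromorphic function on $\mathbb C$ of finite order $\sigma=\limsup_{r\to\infty}\log^+T(r,f)/\log r$, where $T(r,f)$ is the Nevanlinna characteristic. For a function $\omega:\mathbb C\to\mathbb C$ and $a\in\mathbb C$ let $n_{\Delta_\omega}(r,1/(f-a))$ be the number of points $z_0$ with $|z_0|\le r$ that are common zeros of $f-a$ and of $\Delta_{\omega}f:z\mapsto f(z+\omega(z_0))-f(z)$ (the step being fixed at its value at $z_0$), each counted with the minimum of its two multiplicities (a function that vanishes identically having a zero of multiplicity $\infty$); let $$N_{\Delta_\omega}\Big(r,\frac1{f-a}\Big)=\int_0^r\frac{n_{\Delta_\omega}(t,\frac1{f-a})-n_{\Delta_\omega}(0,\frac1{f-a})}{t}\,dt+n_{\Delta_\omega}\Big(0,\frac1{f-a}\Big)\log r,$$ $$\widetilde N_{\Delta_\omega}\Big(r,\frac1{f-a}\Big)=N\Big(r,\frac1{f-a}\Big)-N_{\Delta_\omega}\Big(r,\frac1{f-a}\Big),$$ where $N$ is the usual integrated counting function with multiplicities. For $a=\infty$, read $N(r,f)$ for $N(r,1/(f-a))$ and count the common zeros of $1/f$ and $\Delta_\omega(1/f)$.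 Call $a\in\mathbb C\cup\{\infty\}$ a Picard exceptional value of $f$ for a varying-steps difference operator with infinite period if there is a function $\omega:\mathbb C\to\mathbb C$ such that $\widetilde N_{\Delta_\omega}(r,1/(f-a))=O(1)$ as $r\to\infty$ and 1. if $\sigma>0$: for some $\beta$ with $0<\beta<\min\{1,\sigma\}$ and all $|z|>1$, $|\omega(z)|=|z|^{\beta/2}$ and $|z+\omega(z)|<|z|-|z|^{\beta/4}$; 2. if $\sigma=0$: for all $|z|>1$, $|\omega(z)|=(\log|z|)^{1/4}$ and $|z+\omega(z)|<|z|$, and for all $|z|>e$ moreover $|z+\omega(z)|<|z|-(\log|z|)^{1/8}$; 3. in both cases, for all $0<|z|\le1$, $|\omega(z)|=|z|/2$ and $|z+\omega(z)|<\frac34|z|$. If $f$ has three distinct Picard exceptional values for varying-steps difference operators with infinite period, then $f$ is constant. -/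

import Mathlib

open Filter

noncomputable section

namespace InfinitePeriod

/-- The order of growth `limsup_{r → ∞} log⁺ T(r, f) / log r` of a meromorphic function `f` on the
plane, where `T(r, f)` is the Nevanlinna characteristic. The limit superior is taken in the extended
reals, so that it is `⊤` when `f` has infinite order. -/
def growthOrder (f : ℂ → ℂ) : EReal :=
  limsup (fun r : ℝ ↦
    ((Real.posLog (ValueDistribution.characteristic f ⊤ r) / Real.log r : ℝ) : EReal)) atTop

/-- The difference `Δ_w f (z) = f (z + w) - f z` with step `w`. -/
def stepDiff (w : ℂ) (f : ℂ → ℂ) : ℂ → ℂ := fun z ↦ f (z + w) - f z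

/-- For a step function `ω`, the multiplicity of `z` as a common zero of `f - a` and of
`Δ_w f` with `w = ω z`: the minimum of the two multiplicities, hence `0` if `z` is not a common
zero. The multiplicity of a zero is the positive part of the order of the meromorphic function; it
is `⊤` for `Δ_w f` if that function vanishes identically. -/
def commonZeroMult (ω : ℂ → ℂ) (f : ℂ → ℂ) (a : ℂ) (z : ℂ) : ℤ :=
  (min (((MeromorphicOn.divisor (fun u ↦ f u - a) Set.univ)⁺ z : ℤ) : WithTop ℤ)
    (max 0 (meromorphicOrderAt (stepDiff (ω z) f) z))).untop₀

lemma commonZeroMult_support_subset (ω : ℂ → ℂ) (f : ℂ → ℂ) (a : ℂ) :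
    (commonZeroMult ω f a).support ⊆
      (MeromorphicOn.divisor (fun u ↦ f u - a) Set.univ)⁺.support := by
  intro z hz
  rw [Function.mem_support] at hz ⊢
  intro h
  apply hz
  unfold commonZeroMult
  rw [h]
  simp

/-- The common zeros of `f - a` and `Δ_ω f`, with multiplicities, as a function on the plane with
locally finite support. -/
def commonZeros (ω : ℂ → ℂ) (f : ℂ → ℂ) (a : ℂ) : Function.locallyFinsupp ℂ ℤ where
  toFun := commonZeroMult ω f a
  supportWithinDomain' := Set.subset_univ _
  supportLocallyFiniteWithinDomain' z hz := by
    obtain ⟨t, ht, hfin⟩ :=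
      (MeromorphicOn.divisor (fun u ↦ f u - a) Set.univ)⁺.supportLocallyFiniteWithinDomain' z hz
    exact ⟨t, ht, hfin.subset
      (Set.inter_subset_inter_right t (commonZeroMult_support_subset ω f a))⟩

/-- The varying-steps difference integrated counting function: `N_{Δ_ω}(r, 1/(f - a))` for finite
`a`, and `N_{Δ_ω}(r, f)`, which counts the common zeros of `1/f` and `Δ_ω (1/f)`, for `a = ∞`. It
is the integrated (logarithmic) counting function
`∫₀^r (n(t) - n(0)) / t dt + n(0) log r` of the common zeros. -/
def diffLogCounting (ω : ℂ → ℂ) (f : ℂ → ℂ) : WithTop ℂ → ℝ → ℝ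
  | (a : ℂ) => Function.locallyFinsuppWithin.logCounting (commonZeros ω f a)
  | ⊤ => Function.locallyFinsuppWithin.logCounting (commonZeros ω f⁻¹ 0)

/-- `Ñ_{Δ_ω}(r, 1/(f - a)) = N(r, 1/(f - a)) - N_{Δ_ω}(r, 1/(f - a))`, and for `a = ∞`
`Ñ_{Δ_ω}(r, f) = N(r, f) - N_{Δ_ω}(r, f)`. -/
def reducedDiffLogCounting (ω : ℂ → ℂ) (f : ℂ → ℂ) (a : WithTop ℂ) (r : ℝ) : ℝ :=
  ValueDistribution.logCounting f a r - diffLogCounting ω f a r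

/-- The steps `ω z` allowed for a function of order `σ` in the definition of exceptional values with
infinite period. In the case `σ = 0` the bound `|z| - (log |z|)^(1/8)` is imposed only for
`|z| > e`, because it contradicts `|ω z| = (log |z|)^(1/4)` for `1 < |z| ≤ e`; there only
`|z + ω z| < |z|` is asked for. Nothing is asked for at `z = 0`. -/
structure IsInfinitePeriodStep (σ : EReal) (ω : ℂ → ℂ) : Prop where
  outer_of_pos : 0 < σ → ∃ β : ℝ, 0 < β ∧ β < 1 ∧ (β : EReal) < σ ∧
    ∀ z : ℂ, 1 < ‖z‖ → ‖ω z‖ = ‖z‖ ^ (β / 2) ∧ ‖z + ω z‖ < ‖z‖ - ‖z‖ ^ (β / 4)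
  outer_of_zero : σ = 0 → ∀ z : ℂ, 1 < ‖z‖ →
    ‖ω z‖ = Real.log ‖z‖ ^ (1 / 4 : ℝ) ∧ ‖z + ω z‖ < ‖z‖ ∧
      (Real.exp 1 < ‖z‖ → ‖z + ω z‖ < ‖z‖ - Real.log ‖z‖ ^ (1 / 8 : ℝ))
  inner : ∀ z : ℂ, z ≠ 0 → ‖z‖ ≤ 1 → ‖ω z‖ = ‖z‖ / 2 ∧ ‖z + ω z‖ < 3 / 4 * ‖z‖

/-- `a ∈ ℂ ∪ {∞}` is a Picard exceptional value of `f` for a varying-steps difference operator with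
infinite period. -/
def IsPicardExceptional (f : ℂ → ℂ) (a : WithTop ℂ) : Prop :=
  ∃ ω : ℂ → ℂ, IsInfinitePeriodStep (growthOrder f) ω ∧
    reducedDiffLogCounting ω f a =O[atTop] (fun _ : ℝ ↦ (1 : ℝ))

end InfinitePeriod

end

/-! ### Zero-free functions of finite order -/

open Topology Metric

/-! A nonzero effective divisor has an unbounded logarithmic counting function, so a bounded `Ñ`
forces every `a`-point `z` of `f` to be a common zero with full multiplicity. Then `f` takes `a`
again at `z + ω z`, which is nonzero and strictly closer to the origin if `z ≠ 0`. For nonconstant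
`f` the `a`-points in a closed disc are finitely many, so a nonzero one of least modulus is
impossible (`order_pos_add_step`, `order_nonpos_of_reduced_isBigO`).

Thus each exceptional value is taken at most at `0`, and only one of the three can be taken there. A
Möbius map sends the two omitted values to `0` and `∞`, and finite order makes the resulting
function `exp p` with `p` a polynomial. If `p` is nonconstant, `exp p` takes every `b ≠ 0` at two
distinct points, hence away from the origin, contradicting the third value. -/

/-- An entire function of polynomial growth is a polynomial. -/
theorem exists_polynomial_of_norm_le_pow {h : ℂ → ℂ} (hh : Differentiable ℂ h) {C : ℝ} {k : ℕ}
    (hb : ∀ᶠ r : ℝ in atTop, ∀ z : ℂ, ‖z‖ ≤ r → ‖h z‖ ≤ C * r ^ k) :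
    ∃ p : Polynomial ℂ, ∀ z, h z = p.eval z := by
  have hvan (n : ℕ) (hn : k < n) : iteratedDeriv n h 0 = 0 := by
    rw [← norm_le_zero_iff]
    -- This is Cauchy's estimate for the `n`-th derivative on the circle of radius `r`.
    have ht : Tendsto (fun r : ℝ ↦ n.factorial * C * (r ^ (n - k))⁻¹) atTop (𝓝 0) := by
      simpa using (tendsto_inv_atTop_zero.comp
        (tendsto_pow_atTop (α := ℝ) (Nat.sub_ne_zero_of_lt hn))).const_mul (n.factorial * C)
    refine ge_of_tendsto ht ?_
    filter_upwards [hb, eventually_gt_atTop 0] with r hr hr0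
    refine (Complex.norm_iteratedDeriv_le_of_forall_mem_sphere_norm_le n hr0 hh.diffContOnCl
      fun z hz ↦ hr z (by simpa using (mem_sphere_zero_iff_norm.1 hz).le)).trans_eq ?_
    have : r ^ n = r ^ k * r ^ (n - k) := by rw [← pow_add]; congr 1; omega
    rw [this]
    field_simp
  refine ⟨∑ n ∈ Finset.range (k + 1),
    Polynomial.C ((n.factorial : ℂ)⁻¹ * iteratedDeriv n h 0) * Polynomial.X ^ n, fun z ↦ ?_⟩
  rw [← Complex.taylorSeries_eq_of_entire' 0 z hh, tsum_eq_sum (s := Finset.range (k + 1))]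
  · simp [Polynomial.eval_finsetSum]
  · intro n hn
    rw [hvan n (by simpa using hn)]
    simp

/-- A zero-free entire function has an entire logarithm. -/
theorem exists_differentiable_exp_eq {G : ℂ → ℂ} (hG : Differentiable ℂ G) (h0 : ∀ z, G z ≠ 0) :
    ∃ h : ℂ → ℂ, Differentiable ℂ h ∧ ∀ z, Complex.exp (h z) = G z := by
  have := convex_univ.contractibleSpace (Set.univ_nonempty (α := ℂ))
  have hU : IsSimplyConnected (Set.univ : Set ℂ) :=
    inferInstanceAs (SimplyConnectedSpace (Set.univ : Set ℂ))
  obtain ⟨h, hc, he⟩ := Complex.exists_continuousOn_eqOn_exp_comp (X := ℂ) (U := Set.univ) hU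
    isOpen_univ hG.continuous.continuousOn (by simpa using h0)
  have he' : ∀ z, Complex.exp (h z) = G z := fun z ↦ he (Set.mem_univ z)
  refine ⟨h, fun z ↦ ?_, he'⟩
  -- The lifted logarithm is only known to be continuous; it is differentiable because `exp` has
  -- nonzero derivative.
  exact (HasDerivAt.of_comp_left (continuousOn_univ.1 hc).continuousAt
    (Complex.hasDerivAt_exp (h z)) (hG z).hasDerivAt (Complex.exp_ne_zero _)
    (Eventually.of_forall he')).differentiableAt

/-- The Poisson bound: the real part is bounded by its mean positive part. -/
theorem re_le_mul_circleAverage_posPart {h : ℂ → ℂ} (hh : Differentiable ℂ h) {R : ℝ}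
    {w : ℂ} (hw : w ∈ ball (0 : ℂ) R) :
    (h w).re ≤ (R + ‖w‖) / (R - ‖w‖) * Real.circleAverage (fun z ↦ max 0 (h z).re) 0 R := by
  have hP := hh.diffContOnCl.circleAverage_re_herglotzRieszKernel_smul' (c := 0) hw
  have hR : 0 < R := pos_of_mem_ball hw
  have hk : ContinuousOn (fun z : ℂ ↦ ((z - 0 + (w - 0)) / ((z - 0) - (w - 0))).re)
      (sphere 0 |R|) := by
    refine Complex.continuous_re.comp_continuousOn (ContinuousOn.div (by fun_prop) (by fun_prop) ?_)
    intro z hz h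
    rw [abs_of_pos hR] at hz
    have : z = w := by simpa [sub_eq_zero] using h
    subst this
    simp at hz hw
    linarith
  have hi : CircleIntegrable (fun z ↦ ((z - 0 + (w - 0)) / ((z - 0) - (w - 0))).re • h z) 0 R :=
    (hk.smul hh.continuous.continuousOn).circleIntegrable'
  have hre := Complex.reCLM.circleAverage_comp_comm hi
  rw [hP] at hre
  simp only [Complex.reCLM_apply] at hre
  rw [← hre, ← smul_eq_mul, ← Real.circleAverage_fun_smul]
  refine Real.circleAverage_mono ?_ ?_ ?_
  · exact (Complex.continuous_re.comp_continuousOn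
      (hk.smul hh.continuous.continuousOn)).circleIntegrable'
  · have : Continuous h := hh.continuous
    exact Continuous.continuousOn (by fun_prop) |>.circleIntegrable'
  · intro z hz
    rw [abs_of_pos hR] at hz
    have h1 := re_herglotzRieszKernel_le hz hw
    have h2 := le_re_herglotzRieszKernel hz hw
    have hw' : ‖w‖ < R := by simpa using hw
    simp only [sub_zero] at h1 h2
    have h3 : 0 ≤ (R - ‖w‖) / (R + ‖w‖) := div_nonneg (by linarith) (by positivity)
    simp only [Function.comp_apply, Complex.reCLM_apply, smul_eq_mul, Complex.real_smul,
      Complex.re_ofReal_mul, sub_zero]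
    -- The kernel is nonnegative, so `re h` may be replaced by its positive part before the kernel
    -- is bounded.
    exact (mul_le_mul_of_nonneg_left (le_max_right 0 _) (h3.trans h2)).trans
      (mul_le_mul_of_nonneg_right h1 (le_max_left _ _))

/-- The Nevanlinna characteristic of `exp h` is at least the mean positive part of `re h`. -/
theorem circleAverage_posPart_le_characteristic_exp (h : ℂ → ℂ) {r : ℝ} (hr : 1 ≤ r) :
    Real.circleAverage (fun z ↦ max 0 (h z).re) 0 r ≤
      ValueDistribution.characteristic (fun z ↦ Complex.exp (h z)) ⊤ r := by
  have : Real.circleAverage (fun z ↦ max 0 (h z).re) 0 r =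
      ValueDistribution.proximity (fun z ↦ Complex.exp (h z)) ⊤ r := by
    simp [ValueDistribution.proximity_top, Real.posLog, Complex.norm_exp]
  rw [this]
  exact le_add_of_nonneg_right (ValueDistribution.logCounting_nonneg hr)

/-- If `exp h` has finite order, then the entire function `h` is a polynomial. -/
theorem exists_polynomial_of_characteristic_exp_isBigO {h : ℂ → ℂ} (hh : Differentiable ℂ h)
    {k : ℕ} (hT : ValueDistribution.characteristic (fun z ↦ Complex.exp (h z)) ⊤ =O[atTop]
      fun r : ℝ ↦ r ^ k) :
    ∃ p : Polynomial ℂ, ∀ z, h z = p.eval z := by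
  obtain ⟨C, hC0, hC⟩ := hT.exists_pos
  have hC4 := (tendsto_id.const_mul_atTop (by norm_num : (0 : ℝ) < 4)).eventually hC.bound
  -- Radii `r < 2r < 4r`: the Poisson bound from `4r` controls `re h` on the disc of radius `2r`
  -- with factor `3`, and Borel–Carathéodory then controls `‖h‖` for `‖z‖ ≤ r`.
  refine exists_polynomial_of_norm_le_pow hh (C := 2 * (3 * C * 4 ^ k) + 3 * ‖h 0‖) (k := k) ?_
  filter_upwards [hC4, eventually_ge_atTop 1] with r hr hr1 z hz
  have hr0 : 0 < r := by linarith
  have hM : ∀ w ∈ ball (0 : ℂ) (2 * r), (h w).re ≤ 3 * C * 4 ^ k * r ^ k := by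
    intro w hw
    have hw' : ‖w‖ < 2 * r := by simpa using hw
    have hwR : w ∈ ball (0 : ℂ) (4 * r) := by simp; linarith
    refine (re_le_mul_circleAverage_posPart hh hwR).trans ?_
    have hA : Real.circleAverage (fun z ↦ max 0 (h z).re) 0 (4 * r) ≤ C * (4 * r) ^ k := by
      refine (circleAverage_posPart_le_characteristic_exp h (by linarith)).trans
        ((le_abs_self _).trans ?_)
      simpa [abs_of_pos hr0] using hr
    have hK : (4 * r + ‖w‖) / (4 * r - ‖w‖) ≤ 3 := by
      rw [div_le_iff₀ (by linarith)]; linarith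
    calc _ ≤ 3 * (C * (4 * r) ^ k) := by
          refine mul_le_mul hK hA ?_ (by norm_num)
          exact Real.circleAverage_nonneg_of_nonneg fun _ _ ↦ le_max_left _ _
      _ = _ := by rw [mul_pow]; ring
  have hzR : z ∈ ball (0 : ℂ) (2 * r) := by simp; linarith
  refine (Complex.borelCaratheodory (by positivity) hh.differentiableOn hM (by positivity)
    hzR).trans ?_
  have h1 : ‖z‖ / (2 * r - ‖z‖) ≤ 1 := by
    rw [div_le_iff₀ (by linarith)]; linarith
  have h2 : (2 * r + ‖z‖) / (2 * r - ‖z‖) ≤ 3 := by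
    rw [div_le_iff₀ (by linarith)]; linarith
  calc _ = 2 * (3 * C * 4 ^ k * r ^ k) * (‖z‖ / (2 * r - ‖z‖)) +
        ‖h 0‖ * ((2 * r + ‖z‖) / (2 * r - ‖z‖)) := by ring
    _ ≤ 2 * (3 * C * 4 ^ k * r ^ k) * 1 + ‖h 0‖ * 3 := by gcongr
    _ ≤ 2 * (3 * C * 4 ^ k * r ^ k) * 1 + ‖h 0‖ * (3 * r ^ k) := by
        gcongr
        linarith [one_le_pow₀ hr1 (n := k)]
    _ = _ := by ring

/-- A meromorphic function of finite order without zeros and poles that takes a nonzero value at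
most at the origin is constant. -/
theorem exists_eq_const_of_order_eq_zero_of_omits {g : ℂ → ℂ} (hg : Meromorphic g) {k : ℕ}
    (hT : ValueDistribution.characteristic g ⊤ =O[atTop] fun r : ℝ ↦ r ^ k)
    (h0 : ∀ z, meromorphicOrderAt g z = 0) {b : ℂ} (hb : b ≠ 0)
    (hgb : ∀ z ≠ 0, ¬ Tendsto g (𝓝[≠] z) (𝓝 b)) :
    ∃ c : ℂ, g =ᶠ[codiscrete ℂ] fun _ ↦ c := by
  have hgm : MeromorphicOn g Set.univ := fun z _ ↦ hg z
  set G := toMeromorphicNFOn g Set.univ with hG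
  have hgG : g =ᶠ[codiscrete ℂ] G := toMeromorphicNFOn_eqOn_codiscrete hgm
  have hNF := meromorphicNFOn_toMeromorphicNFOn g Set.univ
  have hord (z : ℂ) : meromorphicOrderAt G z = 0 := by
    rw [← h0 z]; exact meromorphicOrderAt_toMeromorphicNFOn hgm (Set.mem_univ z)
  have hGd : Differentiable ℂ G := fun z ↦
    ((hNF (Set.mem_univ z)).meromorphicOrderAt_nonneg_iff_analyticAt.1 (hord z).ge).differentiableAt
  have hG0 (z : ℂ) : G z ≠ 0 :=
    (hNF (Set.mem_univ z)).meromorphicOrderAt_eq_zero_iff.1 (hord z)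
  obtain ⟨h, hhd, he⟩ := exists_differentiable_exp_eq hGd hG0
  have hGh : (fun z ↦ Complex.exp (h z)) = G := funext he
  have hTG : ValueDistribution.characteristic (fun z ↦ Complex.exp (h z)) ⊤ =O[atTop]
      fun r : ℝ ↦ r ^ k := by
    rw [hGh]
    refine hT.congr' ?_ EventuallyEq.rfl
    filter_upwards [eventually_ne_atTop 0] with r hr
    exact ValueDistribution.characteristic_congr_codiscrete hgG hr
  obtain ⟨p, hp⟩ := exists_polynomial_of_characteristic_exp_isBigO hhd hTG
  by_cases hdeg : p.natDegree = 0
  · refine ⟨G 0, hgG.trans (.of_eq (funext fun z ↦ ?_))⟩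
    rw [← he, ← he, hp, hp, Polynomial.eq_C_of_natDegree_eq_zero hdeg]
    simp
  exfalso
  have hsurj := (Polynomial.isOpenQuotientMap_eval p hdeg).surjective
  have hval (z : ℂ) (hz : z ≠ 0) : G z ≠ b := by
    rintro rfl
    refine hgb z hz (((hGd z).continuousAt.tendsto.mono_left nhdsWithin_le_nhds).congr' ?_)
    exact hgm.toMeromorphicNFOn_eq_self_on_nhdsNE (Set.mem_univ z)
  -- Two distinct logarithms of `b`: both preimages under `p` would have to be the origin.
  obtain ⟨z₁, h₁⟩ := hsurj (Complex.log b)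
  obtain ⟨z₂, h₂⟩ := hsurj (Complex.log b + 2 * Real.pi * Complex.I)
  simp only at h₁ h₂
  have e₁ : z₁ = 0 := by
    by_contra hz
    exact hval z₁ hz (by rw [← he, hp, h₁, Complex.exp_log hb])
  have e₂ : z₂ = 0 := by
    by_contra hz
    exact hval z₂ hz (by rw [← he, hp, h₂, Complex.exp_periodic, Complex.exp_log hb])
  rw [e₁] at h₁
  rw [e₂, h₁] at h₂
  simp [Real.pi_ne_zero] at h₂

/-! ### Values on the Riemann sphere and growth -/

namespace InfinitePeriod

/-- `f` takes the value `a ∈ ℂ ∪ {∞}` at `z`, after removal of singularities. -/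
def TakesAt (f : ℂ → ℂ) (z : ℂ) : WithTop ℂ → Prop
  | (a : ℂ) => Tendsto f (𝓝[≠] z) (𝓝 a)
  | ⊤ => Tendsto f (𝓝[≠] z) (Bornology.cobounded ℂ)

lemma takesAt_coe {f : ℂ → ℂ} {z a : ℂ} : TakesAt f z a ↔ Tendsto f (𝓝[≠] z) (𝓝 a) := Iff.rfl

lemma takesAt_top {f : ℂ → ℂ} {z : ℂ} :
    TakesAt f z ⊤ ↔ Tendsto f (𝓝[≠] z) (Bornology.cobounded ℂ) := Iff.rfl

lemma TakesAt.unique {f : ℂ → ℂ} {z : ℂ} {a b : WithTop ℂ} (ha : TakesAt f z a)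
    (hb : TakesAt f z b) : a = b := by
  induction a with
  | top => induction b with
    | top => rfl
    | coe b =>
      exact (not_tendsto_nhds_of_tendsto_atTop (tendsto_norm_atTop_iff_cobounded.2 ha) _
        (takesAt_coe.1 hb).norm).elim
  | coe a => induction b with
    | top =>
      exact (not_tendsto_nhds_of_tendsto_atTop (tendsto_norm_atTop_iff_cobounded.2 hb) _
        (takesAt_coe.1 ha).norm).elim
    | coe b => rw [tendsto_nhds_unique (takesAt_coe.1 ha) (takesAt_coe.1 hb)]

lemma takesAt_coe_iff {f : ℂ → ℂ} (hf : Meromorphic f) {z a : ℂ} :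
    TakesAt f z a ↔ 0 < meromorphicOrderAt (fun u ↦ f u - a) z := by
  rw [takesAt_coe, ← tendsto_sub_nhds_zero_iff]
  exact tendsto_zero_iff_meromorphicOrderAt_pos ((hf z).sub (.const a z))

lemma takesAt_top_iff {f : ℂ → ℂ} (hf : Meromorphic f) {z : ℂ} :
    TakesAt f z ⊤ ↔ meromorphicOrderAt f z < 0 :=
  tendsto_cobounded_iff_meromorphicOrderAt_neg (hf z)

/-- The finite order is needed: if `f` vanishes near `z`, so does `f⁻¹`, since `0⁻¹ = 0`. -/
lemma takesAt_inv_zero_iff {f : ℂ → ℂ} (hf : Meromorphic f) {z : ℂ}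
    (hz : meromorphicOrderAt f z ≠ ⊤) :
    TakesAt f⁻¹ z (0 : ℂ) ↔ TakesAt f z ⊤ := by
  rw [takesAt_coe_iff hf.inv, takesAt_top_iff hf]
  simp only [sub_zero]
  change 0 < meromorphicOrderAt f⁻¹ z ↔ _
  rw [meromorphicOrderAt_inv]
  lift meromorphicOrderAt f z to ℤ using hz with n
  norm_cast
  simp

lemma takesAt_sub_iff {f : ℂ → ℂ} {z b : ℂ} {a : ℂ} :
    TakesAt (fun u ↦ f u - b) z a ↔ TakesAt f z (a + b : ℂ) := by
  rw [takesAt_coe, takesAt_coe]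
  refine ⟨fun h ↦ ?_, fun h ↦ ?_⟩
  · simpa using h.add_const b
  · simpa using h.sub_const b

lemma takesAt_sub_top_iff {f : ℂ → ℂ} {z b : ℂ} :
    TakesAt (fun u ↦ f u - b) z ⊤ ↔ TakesAt f z ⊤ := by
  rw [takesAt_top, takesAt_top]
  simp_rw [← tendsto_norm_atTop_iff_cobounded]
  refine ⟨fun h ↦ ?_, fun h ↦ ?_⟩
  · refine tendsto_atTop_mono (fun u ↦ ?_) (tendsto_atTop_add_const_right _ (-‖b‖) h)
    linarith [norm_sub_le (f u) b]
  · refine tendsto_atTop_mono (fun u ↦ ?_) (tendsto_atTop_add_const_right _ (-‖b‖) h)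
    linarith [norm_sub_norm_le (f u) b]

lemma TakesAt.of_inv {f : ℂ → ℂ} {z a : ℂ} (ha : a ≠ 0) (h : TakesAt f⁻¹ z a) :
    TakesAt f z (a⁻¹ : ℂ) := by
  rw [takesAt_coe] at h ⊢
  simpa using h.inv₀ ha

/-- Makes the cases `0 < σ` and `σ = 0` of the step condition exhaustive. -/
lemma growthOrder_nonneg (f : ℂ → ℂ) : 0 ≤ growthOrder f := by
  refine le_limsup_of_frequently_le (Eventually.frequently ?_) (by isBoundedDefault)
  filter_upwards [eventually_ge_atTop 1] with r hr
  exact_mod_cast div_nonneg Real.posLog_nonneg (Real.log_nonneg hr)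

/-- A function of finite order has a characteristic of polynomial growth. -/
lemma exists_characteristic_isBigO_pow {f : ℂ → ℂ} (hfin : growthOrder f ≠ ⊤) :
    ∃ k : ℕ, ValueDistribution.characteristic f ⊤ =O[atTop] fun r : ℝ ↦ r ^ k := by
  obtain ⟨x, hx, -⟩ := EReal.lt_iff_exists_real_btwn.1 hfin.lt_top
  obtain ⟨k, hk⟩ := exists_nat_gt x
  refine ⟨k, .of_bound 1 ?_⟩
  filter_upwards [eventually_lt_of_limsup_lt hx (by isBoundedDefault), eventually_gt_atTop 1]
    with r hr hr1
  have hlog := Real.log_pos hr1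
  have h1 : Real.posLog (ValueDistribution.characteristic f ⊤ r) < x * Real.log r := by
    rw [← div_lt_iff₀ hlog]; exact_mod_cast hr
  have h0 : 0 ≤ ValueDistribution.characteristic f ⊤ r :=
    ValueDistribution.characteristic_nonneg hr1.le
  have h2 : Real.log (ValueDistribution.characteristic f ⊤ r) ≤ Real.log (r ^ k) := by
    rw [Real.log_pow]
    exact (le_max_right _ _).trans (h1.le.trans (by gcongr))
  rw [Real.norm_of_nonneg h0, Real.norm_of_nonneg (by positivity), one_mul]
  rcases h0.eq_or_lt with h | h
  · rw [← h]; positivity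
  · exact (Real.log_le_log_iff h (by positivity)).1 h2

/-! ### Descent of the `a`-points towards the origin -/

/-- A step with infinite period moves every point other than the origin closer to the origin, but
not to the origin. -/
lemma IsInfinitePeriodStep.norm_add_lt {σ : EReal} {ω : ℂ → ℂ} (h : IsInfinitePeriodStep σ ω)
    (hσ : 0 ≤ σ) {z : ℂ} (hz : z ≠ 0) : ‖z + ω z‖ < ‖z‖ ∧ z + ω z ≠ 0 := by
  have hz0 : 0 < ‖z‖ := norm_pos_iff.2 hz
  suffices ‖z + ω z‖ < ‖z‖ ∧ ‖ω z‖ < ‖z‖ from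
    ⟨this.1, fun h0 ↦ this.2.ne' (by simpa using congrArg norm (eq_neg_of_add_eq_zero_left h0))⟩
  rcases le_or_gt ‖z‖ 1 with h1 | h1
  · obtain ⟨ha, hb⟩ := h.inner z hz h1
    constructor <;> linarith
  rcases hσ.eq_or_lt with h0 | h0
  · obtain ⟨ha, hb, -⟩ := h.outer_of_zero h0.symm z h1
    refine ⟨hb, ha ▸ ?_⟩
    have hl := Real.log_pos h1
    -- With `t = log ‖z‖`, the step length `t ^ (1/4)` is at most `max 1 t`, which is less than
    -- `‖z‖`.
    rcases le_or_gt (Real.log ‖z‖) 1 with h2 | h2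
    · exact (Real.rpow_le_one hl.le h2 (by norm_num)).trans_lt h1
    · exact (Real.rpow_le_self_of_one_le h2.le (by norm_num)).trans_lt
        (by linarith [Real.log_le_sub_one_of_pos hz0])
  · obtain ⟨β, hβ0, hβ1, -, hβ⟩ := h.outer_of_pos h0
    obtain ⟨ha, hb⟩ := hβ z h1
    refine ⟨hb.trans_le (sub_le_self _ (by positivity)), ha ▸ ?_⟩
    exact (Real.rpow_lt_rpow_of_exponent_lt h1 (by linarith)).trans_eq (Real.rpow_one _)

/-- If the reduced counting function of the `a`-points is bounded, then every `a`-point is a common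
zero, so that its shift by the step is an `a`-point again. -/
lemma order_pos_add_step {F ω : ℂ → ℂ} {a : ℂ} (hF : Meromorphic F)
    (hO : (fun r ↦ Function.locallyFinsuppWithin.logCounting
        (MeromorphicOn.divisor (fun u ↦ F u - a) Set.univ)⁺ r -
      Function.locallyFinsuppWithin.logCounting (commonZeros ω F a) r)
      =O[atTop] (fun _ : ℝ ↦ (1 : ℝ))) {z : ℂ}
    (hz : 0 < meromorphicOrderAt (fun u ↦ F u - a) z)
    (hz' : meromorphicOrderAt (fun u ↦ F u - a) z ≠ ⊤) :
    0 < meromorphicOrderAt (fun u ↦ F u - a) (z + ω z) := by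
  have hFa : Meromorphic (fun u ↦ F u - a) := hF.sub (.const a)
  set D := (MeromorphicOn.divisor (fun u ↦ F u - a) Set.univ)⁺ with hD
  have hE (u : ℂ) : commonZeros ω F a u = commonZeroMult ω F a u := rfl
  have hnn : 0 ≤ D - commonZeros ω F a := by
    intro u
    simp only [Function.locallyFinsuppWithin.coe_zero, Pi.zero_apply,
      Function.locallyFinsuppWithin.coe_sub, Pi.sub_apply, hE, sub_nonneg, commonZeroMult, ← hD]
    exact WithTop.untop₀_le_untop₀ WithTop.coe_ne_top (min_le_left _ _)
  have hzero : D - commonZeros ω F a = 0 := by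
    rw [Function.locallyFinsuppWithin.zero_iff_logCounting_bounded hnn, map_sub]
    exact hO
  have hDz : D z - commonZeroMult ω F a z = 0 := DFunLike.congr_fun hzero z
  obtain ⟨m, hm⟩ := WithTop.ne_top_iff_exists.1 hz'
  have hm0 : 0 < m := by rw [← hm] at hz; exact_mod_cast hz
  have hDm : D z = m := by
    rw [hD, Function.locallyFinsuppWithin.posPart_apply,
      MeromorphicOn.divisor_apply (fun u _ ↦ hFa u) (Set.mem_univ z), ← hm]
    simpa using hm0.le
  have hpos : 0 < meromorphicOrderAt (stepDiff (ω z) F) z := by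
    by_contra hle
    rw [commonZeroMult, ← hD, max_eq_left (not_lt.1 hle), hDm,
      min_eq_right (by exact_mod_cast hm0.le)] at hDz
    simp at hDz
    omega
  rw [← meromorphicOrderAt_fun_comp_add_const_eq_meromorphicOrderAt]
  have hsum : (fun u ↦ F (u + ω z) - a) = stepDiff (ω z) F + fun u ↦ F u - a := by
    ext u; simp [stepDiff]
  rw [hsum]
  -- Non-meromorphic functions have order `0` by default, so the positive order of the difference
  -- already gives its meromorphy.
  exact (lt_min hpos hz).trans_le (meromorphicOrderAt_add
    (meromorphicAt_of_meromorphicOrderAt_ne_zero hpos.ne') (hFa z))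

/-- If the reduced counting function of the `a`-points for a step with infinite period is bounded,
then there are no `a`-points away from the origin. -/
lemma order_nonpos_of_reduced_isBigO {F ω : ℂ → ℂ} {a : ℂ} {σ : EReal} (hF : Meromorphic F)
    (hσ : 0 ≤ σ) (hω : IsInfinitePeriodStep σ ω)
    (hO : (fun r ↦ Function.locallyFinsuppWithin.logCounting
        (MeromorphicOn.divisor (fun u ↦ F u - a) Set.univ)⁺ r -
      Function.locallyFinsuppWithin.logCounting (commonZeros ω F a) r)
      =O[atTop] (fun _ : ℝ ↦ (1 : ℝ)))
    (htop : ∀ z, meromorphicOrderAt (fun u ↦ F u - a) z ≠ ⊤) {z : ℂ} (hz : z ≠ 0) :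
    ¬ 0 < meromorphicOrderAt (fun u ↦ F u - a) z := by
  intro hpos
  have hFa : Meromorphic (fun u ↦ F u - a) := hF.sub (.const a)
  set S := {u : ℂ | u ≠ 0 ∧ ‖u‖ ≤ ‖z‖ ∧ 0 < meromorphicOrderAt (fun u ↦ F u - a) u}
  have hfin : S.Finite := by
    refine ((MeromorphicOn.divisor (fun u ↦ F u - a) (closedBall 0 ‖z‖)).finiteSupport
      (isCompact_closedBall 0 ‖z‖)).subset fun u hu ↦ ?_
    rw [Function.mem_support,
      MeromorphicOn.divisor_apply (fun u _ ↦ hFa u) (by simpa using hu.2.1)]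
    simpa [htop u] using hu.2.2.ne'
  obtain ⟨u, hu, hmin⟩ := Set.exists_min_image S norm hfin ⟨z, hz, le_rfl, hpos⟩
  obtain ⟨hlt, hne⟩ := hω.norm_add_lt hσ hu.1
  exact (hmin _ ⟨hne, hlt.le.trans hu.2.1, order_pos_add_step hF hO hu.2.2 (htop u)⟩).not_gt hlt

/-- An exceptional value with infinite period is taken at most at the origin. -/
lemma IsPicardExceptional.not_takesAt {f : ℂ → ℂ} (hf : Meromorphic f) {a : WithTop ℂ}
    (ha : IsPicardExceptional f a)
    (htop : ∀ c z : ℂ, meromorphicOrderAt (fun u ↦ f u - c) z ≠ ⊤) {z : ℂ} (hz : z ≠ 0) :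
    ¬ TakesAt f z a := by
  obtain ⟨ω, hω, hO⟩ := ha
  induction a with
  | coe c =>
    rw [takesAt_coe_iff hf]
    refine order_nonpos_of_reduced_isBigO hf (growthOrder_nonneg f) hω (hO.congr_left fun r ↦ ?_)
      (htop c) hz
    rw [reducedDiffLogCounting, ValueDistribution.logCounting_coe]
    rfl
  | top =>
    have htop' (u : ℂ) : meromorphicOrderAt f u ≠ ⊤ := by simpa using htop 0 u
    have hfin : (fun u ↦ f⁻¹ u - 0) = f⁻¹ := by ext; simp
    rw [← takesAt_inv_zero_iff hf (htop' z), takesAt_coe_iff hf.inv]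
    refine order_nonpos_of_reduced_isBigO hf.inv (growthOrder_nonneg f) hω
      (hO.congr_left fun r ↦ ?_) (fun u ↦ ?_) hz
    -- Poles of `f` are counted as zeros of `f⁻¹`.
    · have h := ValueDistribution.logCounting_inv (f := f⁻¹)
      rw [inv_inv, ValueDistribution.logCounting_zero] at h
      rw [reducedDiffLogCounting, h, hfin]
      rfl
    · rw [hfin, meromorphicOrderAt_inv]
      have := htop' u
      lift meromorphicOrderAt f u to ℤ using this with n
      exact WithTop.coe_ne_top

end InfinitePeriod

/-- Identity theorem: infinite order at one point spreads over the connected plane. -/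
lemma exists_eventuallyEq_const_of_order_eq_top {f : ℂ → ℂ} (hf : Meromorphic f) {c z : ℂ}
    (h : meromorphicOrderAt (fun u ↦ f u - c) z = ⊤) : f =ᶠ[codiscrete ℂ] fun _ ↦ c := by
  have hfc : MeromorphicOn (fun u ↦ f u - c) Set.univ := fun u _ ↦ (hf u).sub (.const c u)
  have hall (u : ℂ) : meromorphicOrderAt (fun u ↦ f u - c) u = ⊤ := by
    by_contra hu
    exact hfc.meromorphicOrderAt_ne_top_of_isPreconnected isPreconnected_univ (Set.mem_univ u)
      (Set.mem_univ z) hu h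
  rw [EventuallyEq, Filter.Eventually, mem_codiscrete]
  intro u
  rw [disjoint_principal_right, compl_compl]
  filter_upwards [meromorphicOrderAt_eq_top_iff.1 (hall u)] with v hv
  exact sub_eq_zero.1 hv

/-! ### Möbius reduction and conclusion -/

namespace InfinitePeriod

/-- Carries polynomial growth through translation and inversion, which change the characteristic by
`O(1)` (first main theorem). -/
lemma isBigO_pow_of_sub_isBigO_one {T S : ℝ → ℝ} {k : ℕ} (hT : T =O[atTop] fun r : ℝ ↦ r ^ k)
    (h : (T - S) =O[atTop] (1 : ℝ → ℝ)) : S =O[atTop] fun r : ℝ ↦ r ^ k := by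
  have h1 : (1 : ℝ → ℝ) =O[atTop] fun r : ℝ ↦ r ^ k := by
    refine .of_bound 1 ?_
    filter_upwards [eventually_ge_atTop 1] with r hr
    simpa [abs_of_pos (zero_lt_one.trans_le hr)] using one_le_pow₀ hr
  simpa using hT.sub (h.trans h1)

/-- A meromorphic function of finite order that omits `∞` and a finite value, and takes another
finite value at most at the origin, is constant. -/
theorem exists_eq_const_of_omits_top {f : ℂ → ℂ} (hf : Meromorphic f) {k : ℕ}
    (hT : ValueDistribution.characteristic f ⊤ =O[atTop] fun r : ℝ ↦ r ^ k) {b c : ℂ}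
    (hbc : b ≠ c) (htop : ∀ z, ¬ TakesAt f z ⊤) (hc : ∀ z, ¬ TakesAt f z c)
    (hb : ∀ z ≠ 0, ¬ TakesAt f z b) :
    ∃ d : ℂ, f =ᶠ[codiscrete ℂ] fun _ ↦ d := by
  have hg : Meromorphic (fun u ↦ f u - c) := hf.sub (.const c)
  have h0 (z : ℂ) : meromorphicOrderAt (fun u ↦ f u - c) z = 0 := by
    refine le_antisymm (not_lt.1 fun h ↦ hc z ((takesAt_coe_iff hf).2 h))
      (not_lt.1 fun h ↦ htop z ?_)
    rwa [← takesAt_top_iff hg, takesAt_sub_top_iff] at h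
  obtain ⟨d, hd⟩ := exists_eq_const_of_order_eq_zero_of_omits hg (b := b - c)
    (isBigO_pow_of_sub_isBigO_one hT
      (ValueDistribution.isBigO_characteristic_sub_characteristic_shift hf))
    h0 (sub_ne_zero.2 hbc)
    (fun z hz h ↦ hb z hz (by simpa using takesAt_sub_iff.1 (takesAt_coe.2 h)))
  refine ⟨d + c, hd.mono fun u hu ↦ ?_⟩
  simp only at hu ⊢
  rw [← hu, sub_add_cancel]

/-- A meromorphic function of finite order that omits two values of the Riemann sphere, and takes a
third one at most at the origin, is constant. -/
theorem exists_eq_const_of_omits {f : ℂ → ℂ} (hf : Meromorphic f) {k : ℕ}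
    (hT : ValueDistribution.characteristic f ⊤ =O[atTop] fun r : ℝ ↦ r ^ k) {a b c : WithTop ℂ}
    (hab : a ≠ b) (hac : a ≠ c) (hbc : b ≠ c)
    (ha : ∀ z ≠ 0, ¬ TakesAt f z a) (hb : ∀ z, ¬ TakesAt f z b) (hc : ∀ z, ¬ TakesAt f z c) :
    ∃ d : ℂ, f =ᶠ[codiscrete ℂ] fun _ ↦ d := by
  induction b with
  | top =>
    lift a to ℂ using hab
    lift c to ℂ using hbc.symm
    exact exists_eq_const_of_omits_top hf hT (by exact_mod_cast hac) hb hc ha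
  | coe b =>
  induction c with
  | top =>
    lift a to ℂ using hac
    exact exists_eq_const_of_omits_top hf hT (by exact_mod_cast hab) hc hb ha
  | coe c =>
  by_contra hconst
  have htop (z : ℂ) : meromorphicOrderAt (fun u ↦ f u - c) z ≠ ⊤ :=
    fun h ↦ hconst ⟨c, exists_eventuallyEq_const_of_order_eq_top hf h⟩
  have hfc : Meromorphic (fun u ↦ f u - c) := hf.sub (.const c)
  have hbc' : b - c ≠ 0 := sub_ne_zero.2 (by exact_mod_cast hbc)
  have hval {z e : ℂ} (he : e ≠ 0) (h : TakesAt (fun u ↦ f u - c)⁻¹ z e) :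
      TakesAt f z (e⁻¹ + c : ℂ) := takesAt_sub_iff.1 (h.of_inv he)
  have hT' := isBigO_pow_of_sub_isBigO_one (isBigO_pow_of_sub_isBigO_one hT
    (ValueDistribution.isBigO_characteristic_sub_characteristic_shift (a₀ := c) hf))
    (ValueDistribution.isBigO_characteristic_sub_characteristic_inv hfc)
  have homit_top (z : ℂ) : ¬ TakesAt (fun u ↦ f u - c)⁻¹ z ⊤ := by
    rw [← takesAt_inv_zero_iff hfc.inv, inv_inv, takesAt_sub_iff, zero_add]
    · exact hc z
    · rw [meromorphicOrderAt_inv]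
      have := htop z
      lift meromorphicOrderAt (fun u ↦ f u - c) z to ℤ using this with n
      exact WithTop.coe_ne_top
  have homit_b (z : ℂ) : ¬ TakesAt (fun u ↦ f u - c)⁻¹ z ((b - c)⁻¹ : ℂ) := fun h ↦
    hb z (by simpa using hval (inv_ne_zero hbc') h)
  suffices ∃ d : ℂ, (fun u ↦ f u - c)⁻¹ =ᶠ[codiscrete ℂ] fun _ ↦ d by
    obtain ⟨d, hd⟩ := this
    refine hconst ⟨d⁻¹ + c, hd.mono fun u hu ↦ ?_⟩
    simp only [Pi.inv_apply] at hu ⊢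
    rw [← hu, inv_inv, sub_add_cancel]
  -- Under `1 / (f - c)` the third value becomes `0` if it is `∞`, and `(a - c)⁻¹` otherwise.
  induction a with
  | top =>
    refine exists_eq_const_of_omits_top hfc.inv hT' (b := 0) (inv_ne_zero hbc').symm homit_top
      homit_b fun z hz h ↦ ha z hz ?_
    rwa [takesAt_inv_zero_iff hfc (htop z), takesAt_sub_top_iff] at h
  | coe a =>
    have hac' : a - c ≠ 0 := sub_ne_zero.2 (by exact_mod_cast hac)
    refine exists_eq_const_of_omits_top hfc.inv hT' (b := (a - c)⁻¹) ?_ homit_top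
      homit_b fun z hz h ↦ ha z hz (by simpa using hval (inv_ne_zero hac') h)
    intro h
    exact hab (by simpa using h)

end InfinitePeriod

theorem theoremT (f : ℂ → ℂ) (hf : Meromorphic f)
    (hfin : InfinitePeriod.growthOrder f ≠ ⊤)
    (a : Fin 3 → WithTop ℂ) (ha : Function.Injective a)
    (hexc : ∀ j, InfinitePeriod.IsPicardExceptional f (a j)) :
    ∃ c : ℂ, f =ᶠ[Filter.codiscrete ℂ] fun _ ↦ c := by
  by_contra hconst
  have htop (c z : ℂ) : meromorphicOrderAt (fun u ↦ f u - c) z ≠ ⊤ :=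
    fun h ↦ hconst ⟨c, exists_eventuallyEq_const_of_order_eq_top hf h⟩
  obtain ⟨k, hk⟩ := InfinitePeriod.exists_characteristic_isBigO_pow hfin
  have homit (j : Fin 3) (z : ℂ) (hz : z ≠ 0) : ¬ InfinitePeriod.TakesAt f z (a j) :=
    (hexc j).not_takesAt hf htop hz
  -- The index `i` is that of the exceptional value taken at the origin; if there is none, any index
  -- serves.
  obtain ⟨i, hi⟩ : ∃ i, ∀ j ≠ i, ∀ z, ¬ InfinitePeriod.TakesAt f z (a j) := by
    by_cases h : ∃ i, InfinitePeriod.TakesAt f 0 (a i)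
    · obtain ⟨i, hi⟩ := h
      refine ⟨i, fun j hj z hz ↦ ?_⟩
      rcases eq_or_ne z 0 with rfl | hz0
      · exact hj (ha (hz.unique hi))
      · exact homit j z hz0 hz
    · refine ⟨0, fun j _ z hz ↦ ?_⟩
      rcases eq_or_ne z 0 with rfl | hz0
      · exact h ⟨j, hz⟩
      · exact homit j z hz0 hz
  have hne : i ≠ i + 1 ∧ i ≠ i + 2 ∧ i + 1 ≠ i + 2 := by
    fin_cases i <;> decide
  exact hconst (InfinitePeriod.exists_eq_const_of_omits hf hk (ha.ne hne.1) (ha.ne hne.2.1)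
    (ha.ne hne.2.2) (homit i) (hi _ hne.1.symm) (hi _ hne.2.1.symm))
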